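/- Let $F:\mathbb{R}^d\to\mathbb{R}$ be a differentiable objective that is bounded below (in the paper, the training loss of the privacy-preserving semantic communication network IBAL as a function of its weights), let $F_1,F_2,\dots$ be random (sampled) objectives, and let $w^{(1)}\in\mathbb{R}^d$ be a given initial point. Let $\beta_1,\beta_2\in[0,1)$, let $(\beta_{1,t})_{t\ge 1}$ be a non-increasing sequence with $0\le\beta_{1,t}\le\beta_1$, and let $\eta_t=1/\sqrt t$. Starting from $m^{(0)}=v^{(0)}=\hat v^{(0)}=0$, the AMSGrad-style Adam iteration is, for $t=1,2,\dots$, $$g_t=\nabla F_t(w^{(t)}),\qquad m^{(t)}=\beta_{1,t}m^{(t-1)}+(1-\beta_{1,t})g_t,\qquad \hat m^{(t)}=\frac{m^{(t)}}{1-\beta_1^t},$$ $$v^{(t)}=\beta_2v^{(t-1)}+(1-\beta_2)g_t^2,\qquad \hat v^{(t)}=\max\Bigl(\hat v^{(t-1)},\frac{v^{(t)}}{1-\beta_2^t}\Bigr),\qquad w^{(t+1)}=w^{(t)}-\eta_t\,\frac{\hat m^{(t)}}{\sqrt{\hat v^{(t)}}},$$ where squares, maxima, square roots and quotients are taken coordinatewise,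 and a coordinate in which $\hat v^{(t)}$ is zero (so that all stochastic gradients so far, and hence $\hat m^{(t)}$, vanish there) is left unchanged. Assume: 1. $F$ has an $L$-Lipschitz gradient in the sense that for some $L>0$ and all $w,w'$, $F(w')-F(w)\le\langle\nabla F(w),w'-w\rangle+\frac L2\|w'-w\|_2^2$. 2. There is $G$ such that, almost surely, $\|\nabla F(w^{(t)})\|_2\le G$ and $\|g_t\|_2\le G$ for all $t\ge 1$. 3. The noise vectors $n_t=g_t-\nabla F(w^{(t)})$, $t\ge 1$, satisfy $\mathbb{E}[n_t]=0$ and are independent. 4. There is $c>0$ such that $\|g_1\|_2\ge c$ almost surely. Then there are constants $G_1,G_2$ independent of $T$ such that for every number of iterations $T\ge 1$, $$\min_{t=1,\dots,T}\mathbb{E}\bigl[\|\nabla F(w^{(t)})\|_2^2\bigr]\le\frac{1}{\sqrt T}\,(G_1+G_2\log T).$$ In particular, the left-hand side is $\mathcal{O}\bigl(\log T/\sqrt T\bigr)$ as $T\to\infty$. -/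

import Mathlib

open MeasureTheory ProbabilityTheory Filter Asymptotics

noncomputable section

namespace AdamIBAL

/-- Parameter space `ℝᵈ` with the Euclidean norm. -/
abbrev Param (d : ℕ) : Type := EuclideanSpace ℝ (Fin d)

/-- The variables carried from one iteration to the next: after iteration `t` these are
`w⁽ᵗ⁺¹⁾`, `m⁽ᵗ⁾`, `v⁽ᵗ⁾` and the running maximum `v̂⁽ᵗ⁾`. -/
structure AdamState (d : ℕ) where
  w : Param d
  m : Param d
  v : Param d
  vhat : Param d

/-- Iteration number `t ≥ 1` with stochastic gradient `g`, momentum weights `β₁ₜ t`, bias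
corrections `1 - β₁ ^ t`, `1 - β₂ ^ t`, and step size `1 / √t`; squares, maxima, square roots and
quotients of vectors are coordinatewise. A coordinate of `v̂⁽ᵗ⁾` vanishes only if that coordinate of
all stochastic gradients so far, hence of `m⁽ᵗ⁾`, vanishes; the quotient is then `0 / 0 = 0`, so the
coordinate is not moved. -/
def adamStep {d : ℕ} (β₁ β₂ : ℝ) (β₁ₜ : ℕ → ℝ) (t : ℕ) (g : Param d) (s : AdamState d) :
    AdamState d :=
  let m : Param d := β₁ₜ t • s.m + (1 - β₁ₜ t) • g
  let mhat : Param d := (1 / (1 - β₁ ^ t)) • m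
  let v : Param d := WithLp.toLp 2 fun i => β₂ * s.v i + (1 - β₂) * g i ^ 2
  let vhat : Param d := WithLp.toLp 2 fun i => max (s.vhat i) (v i / (1 - β₂ ^ t))
  { w := WithLp.toLp 2 fun i => s.w i - 1 / √(t : ℝ) * (mhat i / √(vhat i))
    m := m
    v := v
    vhat := vhat }

/-- The state after `k` iterations started at `w₁` with `m⁽⁰⁾ = v⁽⁰⁾ = v̂⁽⁰⁾ = 0`; iteration `t` uses
the gradient of the sampled objective `Fs t` at the current iterate. -/
def adamState {d : ℕ} (β₁ β₂ : ℝ) (β₁ₜ : ℕ → ℝ) (w₁ : Param d) (Fs : ℕ → Param d → ℝ) :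
    ℕ → AdamState d
  | 0 => { w := w₁, m := 0, v := 0, vhat := 0 }
  | k + 1 =>
    let s := adamState β₁ β₂ β₁ₜ w₁ Fs k
    adamStep β₁ β₂ β₁ₜ (k + 1) (gradient (Fs (k + 1)) s.w) s

/-- The iterate `w⁽ᵗ⁾`, for `t ≥ 1`; `w⁽¹⁾ = w₁`. -/
def adamIterate {d : ℕ} (β₁ β₂ : ℝ) (β₁ₜ : ℕ → ℝ) (w₁ : Param d) (Fs : ℕ → Param d → ℝ)
    (t : ℕ) : Param d :=
  (adamState β₁ β₂ β₁ₜ w₁ Fs (t - 1)).w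

/-- The stochastic gradient `g_t = ∇F_t(w⁽ᵗ⁾)`, for `t ≥ 1`. -/
def stochGrad {d : ℕ} (β₁ β₂ : ℝ) (β₁ₜ : ℕ → ℝ) (w₁ : Param d) (Fs : ℕ → Param d → ℝ)
    (t : ℕ) : Param d :=
  gradient (Fs t) (adamIterate β₁ β₂ β₁ₜ w₁ Fs t)

/-- The gradient noise `n_t = g_t - ∇F(w⁽ᵗ⁾)`, for `t ≥ 1`. -/
def gradNoise {d : ℕ} (F : Param d → ℝ) (β₁ β₂ : ℝ) (β₁ₜ : ℕ → ℝ) (w₁ : Param d)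
    (Fs : ℕ → Param d → ℝ) (t : ℕ) : Param d :=
  stochGrad β₁ β₂ β₁ₜ w₁ Fs t - gradient F (adamIterate β₁ β₂ β₁ₜ w₁ Fs t)

/-- `min_{t = 1, …, T} e t`, for `T ≥ 1` (an infimum over a finite nonempty index set). -/
def minUpTo (e : ℕ → ℝ) (T : ℕ) : ℝ := ⨅ t : Finset.Icc 1 T, e t

end AdamIBAL

end

/-!
The proof is the standard descent argument for Adam-type methods, with two changes.

*Momentum.* Put `A t = ⟪∇F(w⁽ᵗ⁾), w⁽ᵗ⁾ - w⁽ᵗ⁺¹⁾⟫`. The quadratic upper bound on `F` gives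
`∑ A t ≤ F(w₁) - inf F + O(log T)`, because `|m| ≤ √v̂ / √(1 - β₂)` bounds the step `t` by `O(1 / √t)`
in norm, however small `v̂` is. Since the bound is only one-sided, `∇F` need not be Lipschitz; but
adding it for two points gives `⟪∇F x - ∇F y, x - y⟫ ≤ L ‖x - y‖²`, which is the direction needed to
replace `∇F(w⁽ᵗ⁺¹⁾)` by `∇F(w⁽ᵗ⁾)` in the old momentum term. Hence `A` satisfies a discounted recursion
`A (t+1) ≥ β A t + gain - loss + noise` (`inner_gradient_adamUpdate_succ_ge`), which
`sum_gain_le_of_discounted_recursion` sums up.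

*The adaptive denominator.* The stochastic gradient `g = a + n` is correlated with the new
denominator `u' = √v̂⁽ᵗ⁾`, whose old value `u` may be arbitrarily small. With `ε = 1 / √T` there are
two cases in each coordinate. If `|a| ≤ const * (u + ε)`, then replacing `u'` by the past-determined
`u + ε` costs a multiple of `u' - u + ε`, which telescopes up to `∑ ε / √t = O(1)`. If `|a|` is
larger, then, up to noise, it is dominated by the growth of `log (u + ε)`: `g` is of the size of `a`
often enough, and each time it doubles `u + ε` (`abs_le_log_growth_of_large`). The logarithm starts
at `log ε` and so grows by `O(log T)` in total.

In both cases the noise enters linearly, with a weight determined by the past (`noiseWeight`). This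
gives a bound that holds along every trajectory
(`exists_sum_norm_gradient_sq_add_filteredNoise_le`). The iterates are measurable functions of the
earlier noise vectors (`measurable_adamState`), so by independence the noise terms have mean zero
(`integrable_and_integral_filteredNoise_eq_zero`), and taking expectations gives
`∑ E‖∇F(w⁽ᵗ⁾)‖² / √t = O(1 + log T)`. The minimum is at most this sum divided by `∑ 1 / √t ≥ √T`.
-/

namespace AdamIBAL

/-! ### One coordinate of one iteration -/

/-- The weight of the noise coordinate in the one-step estimate `le_mul_momentum_div`, as a function
of the gradient coordinate `a` and of the previous value `u` of `√v̂`. It does not involve the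
current stochastic gradient, so it is determined by the past. The first branch is the one in which
the gradient is large compared with the regularized denominator `u + ε`. -/
noncomputable def noiseWeight (C ε β a u : ℝ) : ℝ :=
  if 4 * C * (u + ε) < |a| then ((1 - β) * (2 * (C + 1)) + 2 * β * C) * (a / |a|)
  else (1 - β) * (a / (u + ε))

/-- If the gradient coordinate `a` is large compared with the denominator `u + ε`, then, up to
noise, it is paid for by the growth of `log (u + ε)`: either the stochastic gradient `g` is small,
and the noise `g - a` points against `a`, or `g` is large and forces `u` to at least double. -/
lemma abs_le_log_growth_of_large {C G ε a g u u' : ℝ} (hC : 1 ≤ C) (hε : 0 < ε) (hu : 0 ≤ u)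
    (huu : u ≤ u') (hg : |g| ≤ G) (hgu : |g| ≤ C * u') (hlarge : 4 * C * (u + ε) < |a|) :
    |a| ≤ 2 * G / Real.log 2 * (Real.log (u' + ε) - Real.log (u + ε))
      - 2 * (a / |a|) * (g - a) := by
  have hG : 0 ≤ G := (abs_nonneg g).trans hg
  have hlog2 : 0 < Real.log 2 := Real.log_pos (by norm_num)
  have ha : 0 < |a| := lt_of_le_of_lt (by positivity) hlarge
  have hσa : a / |a| * a = |a| := by
    rw [div_mul_eq_mul_div, div_eq_iff ha.ne', ← abs_mul_abs_self]
  have hσ : abs (a / |a|) = 1 := by rw [abs_div, abs_abs, div_self ha.ne']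
  have hσg : a / |a| * g ≤ |g| := by
    calc a / |a| * g ≤ abs (a / |a| * g) := le_abs_self _
      _ = |g| := by rw [abs_mul, hσ, one_mul]
  have hmono : Real.log (u + ε) ≤ Real.log (u' + ε) :=
    Real.log_le_log (by positivity) (by linarith)
  have hexp : 2 * (a / |a|) * (g - a) = 2 * (a / |a| * g) - 2 * |a| := by
    linear_combination (-2) * hσa
  rw [hexp]
  rcases le_or_gt (a / |a| * g) (|a| / 2) with h | h
  · have : 0 ≤ 2 * G / Real.log 2 * (Real.log (u' + ε) - Real.log (u + ε)) :=
      mul_nonneg (by positivity) (by linarith)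
    linarith
  · -- `C * u' ≥ |g| > |a| / 2 > C * 2 * (u + ε)`, so `u + ε` doubles
    have hdouble : 2 * (u + ε) ≤ u' + ε := by
      have h1 : C * (2 * (u + ε)) ≤ C * u' := by linarith
      linarith [le_of_mul_le_mul_left h1 (by linarith)]
    have h2 : Real.log 2 ≤ Real.log (u' + ε) - Real.log (u + ε) := by
      have := Real.log_le_log (by positivity) hdouble
      rw [Real.log_mul (by norm_num) (by positivity)] at this
      linarith
    have h3 : 2 * G ≤ 2 * G / Real.log 2 * (Real.log (u' + ε) - Real.log (u + ε)) := by
      calc 2 * G = 2 * G / Real.log 2 * Real.log 2 := by field_simp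
        _ ≤ _ := mul_le_mul_of_nonneg_left h2 (by positivity)
    linarith

/-- Replacing the denominator `u` of a momentum coordinate by the larger `u'` costs at most a
multiple of the relative growth `(u' - u) / u'`, even for vanishing denominators. -/
lemma abs_div_sub_div_le {C m u u' : ℝ} (hC : 0 ≤ C) (hu : 0 ≤ u) (huu : u ≤ u')
    (hm : |m| ≤ C * u) :
    |m / u' - m / u| ≤ C * ((u' - u) / u') := by
  rcases hu.eq_or_lt with rfl | hu0
  · have : m = 0 := by simpa using hm
    rw [this, zero_div, zero_div, sub_zero, abs_zero]
    exact mul_nonneg hC (div_nonneg (by linarith) huu)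
  · have hu' : 0 < u' := hu0.trans_le huu
    have : m / u' - m / u = -(m / u) * ((u' - u) / u') := by field_simp; ring
    rw [this, abs_mul, abs_neg, abs_div, abs_of_pos hu0, abs_of_nonneg (a := (u' - u) / u')
      (div_nonneg (by linarith) hu'.le)]
    exact mul_le_mul_of_nonneg_right ((div_le_iff₀ hu0).2 hm)
      (div_nonneg (by linarith) hu'.le)

/-- The part of the product gradient × update that comes from the current stochastic gradient. -/
lemma le_mul_stochGrad_div {C G ε a g u u' : ℝ} (hC : 1 ≤ C) (hε : 0 < ε) (hε1 : ε ≤ 1)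
    (hu : 0 ≤ u) (huu : u ≤ u') (huG : u' ≤ G) (hgu : |g| ≤ C * u')
    (hsmall : |a| ≤ 4 * C * (u + ε)) :
    a ^ 2 / (G + 1) + a / (u + ε) * (g - a) - 4 * C ^ 2 * (u' - u + ε) ≤ a * (g / u') := by
  have hp : 0 < u + ε := by positivity
  have hgr : g = g / u' * u' := by
    rcases (hu.trans huu).eq_or_lt with h | h
    · rw [← h] at hgu ⊢
      have : g = 0 := by simpa using hgu
      simp [this]
    · field_simp
  have hr : |g / u'| ≤ C := by
    rw [abs_div, abs_of_nonneg (hu.trans huu)]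
    exact div_le_of_le_mul₀ (hu.trans huu) (by linarith) hgu
  generalize g / u' = r at hgr hr
  subst hgr
  have h1 : a ^ 2 / (G + 1) ≤ a ^ 2 / (u + ε) := by
    gcongr; linarith
  have h2 : a ^ 2 / (u + ε) + a / (u + ε) * (r * u' - a)
      = a * r - a / (u + ε) * r * (u + ε - u') := by
    field_simp; ring
  have h3 : |a / (u + ε)| ≤ 4 * C := by
    rw [abs_div, abs_of_pos hp, div_le_iff₀ hp]; exact hsmall
  have h4 : |a / (u + ε) * r * (u + ε - u')| ≤ 4 * C * C * (u' - u + ε) := by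
    rw [abs_mul, abs_mul]
    have : |u + ε - u'| ≤ u' - u + ε := by rw [abs_le]; constructor <;> linarith
    gcongr
  have := (abs_le.1 h4).1
  nlinarith

/-- One-step estimate for one coordinate: gradient times normalized momentum is bounded below by a
`β`-fraction of the same product with the old momentum, a multiple of the squared gradient, and a
noise term with a weight determined by the past, up to errors that telescope in `u` and in
`log (u + ε)`. -/
lemma le_mul_momentum_div {C G ε β a g m u u' : ℝ} (hC : 1 ≤ C) (hε : 0 < ε) (hε1 : ε ≤ 1)
    (hβ : 0 ≤ β) (hβ1 : β ≤ 1) (hu : 0 ≤ u) (huu : u ≤ u') (huG : u' ≤ G) (ha : |a| ≤ G)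
    (hg : |g| ≤ G) (hgu : |g| ≤ C * u') (hm : |m| ≤ C * u) :
    β * (a * (m / u)) + (1 - β) * (a ^ 2 / (G + 1)) + noiseWeight C ε β a u * (g - a)
      - 4 * C ^ 2 * (u' - u + ε)
      - (C + 1) * (2 * G / Real.log 2) * (Real.log (u' + ε) - Real.log (u + ε))
      ≤ a * ((β * m + (1 - β) * g) / u') := by
  have hG : 0 ≤ G := (abs_nonneg g).trans hg
  have hlog2 : 0 < Real.log 2 := Real.log_pos (by norm_num)
  have hu' : 0 ≤ u' := hu.trans huu
  have hℓ : 0 ≤ Real.log (u' + ε) - Real.log (u + ε) :=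
    sub_nonneg.2 (Real.log_le_log (by positivity) (by linarith))
  have hsplit : a * ((β * m + (1 - β) * g) / u')
      = β * (a * (m / u)) + β * (a * (m / u' - m / u)) + (1 - β) * (a * (g / u')) := by ring
  have hJ0 : 0 ≤ (u' - u) / u' := div_nonneg (by linarith) hu'
  have hJ1 : (u' - u) / u' ≤ 1 := div_le_one_of_le₀ (by linarith) hu'
  have hmom : -(|a| * (C * ((u' - u) / u'))) ≤ a * (m / u' - m / u) := by
    have h := mul_le_mul_of_nonneg_left (abs_div_sub_div_le (by linarith) hu huu hm) (abs_nonneg a)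
    rw [← abs_mul] at h
    exact (neg_le_neg h).trans (neg_abs_le _)
  rw [hsplit]
  unfold noiseWeight
  split_ifs with hlarge
  · have hL := abs_le_log_growth_of_large hC hε hu huu hg hgu hlarge
    set ℓ := Real.log (u' + ε) - Real.log (u + ε)
    set σ := a / |a|
    have h1 : -(C * |a|) ≤ a * (m / u' - m / u) := by
      refine le_trans ?_ hmom
      have := mul_le_mul_of_nonneg_left hJ1 (by positivity : 0 ≤ |a| * C)
      nlinarith
    have h2 : -(C * |a|) ≤ a * (g / u') := by
      have hr : |g / u'| ≤ C := by
        rw [abs_div, abs_of_nonneg hu']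
        exact div_le_of_le_mul₀ hu' (by linarith) hgu
      have h := mul_le_mul_of_nonneg_left hr (abs_nonneg a)
      rw [← abs_mul] at h
      linarith [neg_abs_le (a * (g / u'))]
    have h3 : a ^ 2 / (G + 1) ≤ |a| := by
      rw [div_le_iff₀ (by positivity), ← sq_abs]
      nlinarith [abs_nonneg a]
    have hpos : 0 ≤ 2 * G / Real.log 2 * ℓ := by positivity
    have hgm := mul_le_mul_of_nonneg_left h1 hβ
    have hgs := mul_le_mul_of_nonneg_left (h2.trans' (by linarith :
      a ^ 2 / (G + 1) - (C + 1) * |a| ≤ -(C * |a|))) (by linarith : 0 ≤ 1 - β)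
    have hL1 := mul_le_mul_of_nonneg_left hL (by positivity : 0 ≤ β * C)
    have hL2 := mul_le_mul_of_nonneg_left hL
      (mul_nonneg (by linarith) (by linarith) : 0 ≤ (1 - β) * (C + 1))
    have hlast : 0 ≤ β * (2 * G / Real.log 2 * ℓ) := mul_nonneg hβ hpos
    have hsq : 0 ≤ 4 * C ^ 2 * (u' - u + ε) := mul_nonneg (by positivity) (by linarith)
    nlinarith
  · push Not at hlarge
    have hgs := mul_le_mul_of_nonneg_left
      (le_mul_stochGrad_div hC hε hε1 hu huu huG hgu hlarge) (by linarith : 0 ≤ 1 - β)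
    have h1 : |a| * ((u' - u) / u') ≤ 4 * C * (u' - u + ε) := by
      calc |a| * ((u' - u) / u') ≤ 4 * C * (u + ε) * ((u' - u) / u') := by gcongr
        _ = 4 * C * ((u' - u) * (u / u') + ε * ((u' - u) / u')) := by ring
        _ ≤ 4 * C * ((u' - u) * 1 + ε * 1) := by
          have : u / u' ≤ 1 := div_le_one_of_le₀ huu hu'
          have : 0 ≤ u' - u := by linarith
          gcongr
        _ = _ := by ring
    have hgm : -(4 * C ^ 2 * (u' - u + ε)) ≤ a * (m / u' - m / u) := by
      refine le_trans ?_ hmom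
      have := mul_le_mul_of_nonneg_left h1 (by linarith : 0 ≤ C)
      nlinarith
    have hgm' := mul_le_mul_of_nonneg_left hgm hβ
    have hpos : 0 ≤ (C + 1) * (2 * G / Real.log 2)
      * (Real.log (u' + ε) - Real.log (u + ε)) := by positivity
    nlinarith

/-! ### Discounted recursions and elementary sums -/

/-- A sequence that satisfies `a (t+1) ≥ β (t+1) a t + x (t+1) - y (t+1) + ν (t+1)` with a discount
`β ≤ b < 1` collects all the gains `x`, and at most the losses `y` divided by `1 - b`; the signed
terms `ν` enter through the solution `r` of the same linear recursion. -/
lemma sum_gain_le_of_discounted_recursion {b : ℝ} (hb0 : 0 ≤ b) (hb1 : b < 1)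
    {β a r x y ν : ℕ → ℝ} (hβ0 : ∀ t, 0 ≤ β (t + 1)) (hβb : ∀ t, β (t + 1) ≤ b)
    (ha0 : a 0 = 0) (hr0 : r 0 = 0) (hr : ∀ t, r (t + 1) = β (t + 1) * r t + ν (t + 1))
    (ha : ∀ t, β (t + 1) * a t + x (t + 1) - y (t + 1) + ν (t + 1) ≤ a (t + 1))
    (hx : ∀ t, 0 ≤ x (t + 1)) (hy : ∀ t, 0 ≤ y (t + 1)) (T : ℕ) :
    ∑ t ∈ Finset.range T, x (t + 1) + ∑ t ∈ Finset.range T, r (t + 1)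
      ≤ ∑ t ∈ Finset.range T, a (t + 1) + 1 / (1 - b) * ∑ t ∈ Finset.range T, y (t + 1) := by
  have hb : 0 < 1 - b := by linarith
  -- the correction with the negative part of the last term makes the induction close
  have key : ∀ T : ℕ, (1 - b) * ∑ t ∈ Finset.range T, x (t + 1) + b * max (-(a T - r T)) 0
      ≤ (1 - b) * ∑ t ∈ Finset.range T, (a (t + 1) - r (t + 1))
        + ∑ t ∈ Finset.range T, y (t + 1) := by
    intro T
    induction T with
    | zero => simp [ha0, hr0]
    | succ T ih =>
      rw [Finset.sum_range_succ, Finset.sum_range_succ, Finset.sum_range_succ]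
      have hN : 0 ≤ max (-(a T - r T)) 0 := le_max_right _ _
      have hf : -(a T - r T) ≤ max (-(a T - r T)) 0 := le_max_left _ _
      have h1 := mul_le_mul_of_nonneg_left hf (hβ0 T)
      have h2 := mul_le_mul_of_nonneg_right (hβb T) hN
      have h3 := ha T
      have h4 := hr T
      have h5 := hx T
      have h7 := mul_nonneg hb0 (hy T)
      have h8 := mul_nonneg hb0 (mul_nonneg hb0 hN)
      have h6 : x (T + 1) - y (T + 1) - b * max (-(a T - r T)) 0 ≤ a (T + 1) - r (T + 1) := by
        nlinarith
      rcases max_cases (-(a (T + 1) - r (T + 1))) 0 with ⟨h, h'⟩ | ⟨h, h'⟩ <;> rw [h] <;> nlinarith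
  have h := key T
  have hN : 0 ≤ b * max (-(a T - r T)) 0 := mul_nonneg hb0 (le_max_right _ _)
  rw [Finset.sum_sub_distrib] at h
  have h' : (1 - b) * (∑ t ∈ Finset.range T, x (t + 1) + ∑ t ∈ Finset.range T, r (t + 1))
      ≤ (1 - b) * (∑ t ∈ Finset.range T, a (t + 1)
        + 1 / (1 - b) * ∑ t ∈ Finset.range T, y (t + 1)) := by
    have : ∀ A Y : ℝ, (1 - b) * (A + 1 / (1 - b) * Y) = (1 - b) * A + Y := fun A Y => by
      field_simp
    rw [this]
    linarith
  exact le_of_mul_le_mul_left h' hb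

lemma sum_inv_le_one_add_log (T : ℕ) :
    ∑ t ∈ Finset.range T, 1 / ((t : ℝ) + 1) ≤ 1 + Real.log T := by
  have h := harmonic_le_one_add_log T
  rw [harmonic] at h
  push_cast at h
  simpa only [one_div] using h

lemma sum_inv_sqrt_le (T : ℕ) : ∑ t ∈ Finset.range T, 1 / √((t : ℝ) + 1) ≤ 2 * √(T : ℝ) := by
  induction T with
  | zero => simp
  | succ T ih =>
    rw [Finset.sum_range_succ]
    push_cast
    have h0 : 0 < √((T : ℝ) + 1) := by positivity
    have h1 : √((T : ℝ) + 1) ^ 2 = T + 1 := Real.sq_sqrt (by positivity)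
    have h2 : √(T : ℝ) ^ 2 = T := Real.sq_sqrt (by positivity)
    have h3 : 1 / √((T : ℝ) + 1) ≤ 2 * √((T : ℝ) + 1) - 2 * √(T : ℝ) := by
      rw [div_le_iff₀ h0]
      nlinarith [sq_nonneg (√((T : ℝ) + 1) - √(T : ℝ))]
    linarith

lemma sqrt_le_sum_inv_sqrt (T : ℕ) : √(T : ℝ) ≤ ∑ t ∈ Finset.range T, 1 / √((t : ℝ) + 1) := by
  rcases T.eq_zero_or_pos with rfl | hT
  · simp
  calc √(T : ℝ) = ∑ t ∈ Finset.range T, 1 / √(T : ℝ) := by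
        rw [Finset.sum_const, Finset.card_range, nsmul_eq_mul, mul_one_div, Real.div_sqrt]
    _ ≤ _ := by
        refine Finset.sum_le_sum fun t ht => ?_
        have : (t : ℝ) + 1 ≤ T := by exact_mod_cast Finset.mem_range.1 ht
        gcongr

/-! ### Bounds along a trajectory -/

/-- The step size `1 / √t` combined with the bias correction of the momentum. Replacing `t` by
`max t 1` makes the sequence antitone from `t = 0` on. -/
noncomputable def effectiveStep (β₁ : ℝ) (t : ℕ) : ℝ :=
  1 / √((max t 1 : ℕ) : ℝ) * (1 / (1 - β₁ ^ max t 1))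

/-- The vector `w⁽ᵗ⁾ - w⁽ᵗ⁺¹⁾` subtracted in iteration `t`; it vanishes for `t = 0`. -/
noncomputable def adamUpdate {d : ℕ} (β₁ β₂ : ℝ) (β₁ₜ : ℕ → ℝ) (w₁ : Param d)
    (Fs : ℕ → Param d → ℝ) (t : ℕ) : Param d :=
  WithLp.toLp 2 fun i => effectiveStep β₁ t *
    ((adamState β₁ β₂ β₁ₜ w₁ Fs t).m i / √((adamState β₁ β₂ β₁ₜ w₁ Fs t).vhat i))

/-- The noise part of the descent estimate, passed through the momentum filter: every new term is
the current gradient noise, weighted coordinatewise by `noiseWeight` at the current iterate. -/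
noncomputable def filteredNoise {d : ℕ} (F : Param d → ℝ) (β₁ β₂ : ℝ) (β₁ₜ : ℕ → ℝ) (w₁ : Param d)
    (Fs : ℕ → Param d → ℝ) (C ε : ℝ) : ℕ → ℝ
  | 0 => 0
  | t + 1 => β₁ₜ (t + 1) * filteredNoise F β₁ β₂ β₁ₜ w₁ Fs C ε t + effectiveStep β₁ (t + 1) *
      ∑ i, noiseWeight C ε (β₁ₜ (t + 1)) (gradient F (adamState β₁ β₂ β₁ₜ w₁ Fs t).w i)
        √((adamState β₁ β₂ β₁ₜ w₁ Fs t).vhat i) * gradNoise F β₁ β₂ β₁ₜ w₁ Fs (t + 1) i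

section EffectiveStep

variable {β₁ : ℝ}

lemma one_le_inv_one_sub_pow (h0 : 0 ≤ β₁) (h1 : β₁ < 1) (t : ℕ) :
    1 ≤ 1 / (1 - β₁ ^ max t 1) := by
  have h : β₁ ^ max t 1 < 1 := pow_lt_one₀ h0 h1 (by positivity)
  rw [le_div_iff₀ (by linarith)]
  linarith [pow_nonneg h0 (max t 1)]

lemma effectiveStep_nonneg (h0 : 0 ≤ β₁) (h1 : β₁ < 1) (t : ℕ) : 0 ≤ effectiveStep β₁ t :=
  mul_nonneg (by positivity) (by linarith [one_le_inv_one_sub_pow h0 h1 t])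

lemma effectiveStep_le (h0 : 0 ≤ β₁) (h1 : β₁ < 1) (t : ℕ) :
    effectiveStep β₁ t ≤ 1 / √((max t 1 : ℕ) : ℝ) * (1 / (1 - β₁)) := by
  have : β₁ ^ max t 1 ≤ β₁ := pow_le_of_le_one h0 h1.le (by positivity)
  unfold effectiveStep
  gcongr

lemma effectiveStep_le_const (h0 : 0 ≤ β₁) (h1 : β₁ < 1) (t : ℕ) :
    effectiveStep β₁ t ≤ 1 / (1 - β₁) := by
  refine (effectiveStep_le h0 h1 t).trans ?_
  have h2 : 0 ≤ 1 / (1 - β₁) := by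
    have : 0 < 1 - β₁ := by linarith
    positivity
  refine mul_le_of_le_one_left h2 ?_
  rw [div_le_one (by positivity), Real.one_le_sqrt]
  exact_mod_cast le_max_right t 1

lemma inv_sqrt_le_effectiveStep (h0 : 0 ≤ β₁) (h1 : β₁ < 1) (t : ℕ) :
    1 / √((t : ℝ) + 1) ≤ effectiveStep β₁ (t + 1) := by
  have h := one_le_inv_one_sub_pow h0 h1 (t + 1)
  unfold effectiveStep
  refine le_trans ?_ (le_mul_of_one_le_right (by positivity) h)
  simp

lemma effectiveStep_succ_le (h0 : 0 ≤ β₁) (h1 : β₁ < 1) (t : ℕ) :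
    effectiveStep β₁ (t + 1) ≤ effectiveStep β₁ t := by
  have hle : max t 1 ≤ max (t + 1) 1 := by omega
  have h : β₁ ^ max t 1 < 1 := pow_lt_one₀ h0 h1 (by positivity)
  have h' : β₁ ^ max (t + 1) 1 ≤ β₁ ^ max t 1 := pow_le_pow_of_le_one h0 h1.le hle
  have h2 : ((max t 1 : ℕ) : ℝ) ≤ ((max (t + 1) 1 : ℕ) : ℝ) := by exact_mod_cast hle
  unfold effectiveStep
  have : 0 < 1 - β₁ ^ max t 1 := by linarith
  have : 0 < 1 - β₁ ^ max (t + 1) 1 := by linarith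
  gcongr

end EffectiveStep

section Trajectory

variable {d : ℕ} {β₁ β₂ : ℝ} {β₁ₜ : ℕ → ℝ} {w₁ : Param d} {Fs : ℕ → Param d → ℝ}

local notation "st" => adamState β₁ β₂ β₁ₜ w₁ Fs

lemma adamState_succ_m (t : ℕ) (i : Fin d) : (st (t + 1)).m i =
    β₁ₜ (t + 1) * (st t).m i + (1 - β₁ₜ (t + 1)) * stochGrad β₁ β₂ β₁ₜ w₁ Fs (t + 1) i := rfl

lemma adamState_succ_v (t : ℕ) (i : Fin d) : (st (t + 1)).v i =
    β₂ * (st t).v i + (1 - β₂) * stochGrad β₁ β₂ β₁ₜ w₁ Fs (t + 1) i ^ 2 := rfl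

lemma adamState_succ_vhat (t : ℕ) (i : Fin d) : (st (t + 1)).vhat i =
    max ((st t).vhat i) ((st (t + 1)).v i / (1 - β₂ ^ (t + 1))) := rfl

lemma adamIterate_succ (t : ℕ) : adamIterate β₁ β₂ β₁ₜ w₁ Fs (t + 1) =
    adamIterate β₁ β₂ β₁ₜ w₁ Fs t - adamUpdate β₁ β₂ β₁ₜ w₁ Fs t := by
  ext i
  cases t with
  | zero => simp [adamIterate, adamUpdate, adamState]
  | succ t =>
    have hmax : max (t + 1) 1 = t + 1 := by omega
    change (st t).w i - 1 / √((t + 1 : ℕ) : ℝ) *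
        ((1 / (1 - β₁ ^ (t + 1))) * (st (t + 1)).m i / √((st (t + 1)).vhat i))
      = (st t).w i - effectiveStep β₁ (t + 1) * ((st (t + 1)).m i / √((st (t + 1)).vhat i))
    rw [effectiveStep, hmax]
    ring

lemma sqrt_vhat_le_succ (t : ℕ) (i : Fin d) :
    √((st t).vhat i) ≤ √((st (t + 1)).vhat i) :=
  Real.sqrt_le_sqrt (le_max_left _ _)

lemma v_nonneg (hβ₂0 : 0 ≤ β₂) (hβ₂1 : β₂ < 1) (t : ℕ) (i : Fin d) : 0 ≤ (st t).v i := by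
  induction t with
  | zero => simp [adamState]
  | succ t ih =>
    rw [adamState_succ_v]
    have : 0 < 1 - β₂ := by linarith
    positivity

lemma one_sub_pow_pos (hβ₂0 : 0 ≤ β₂) (hβ₂1 : β₂ < 1) (t : ℕ) : 0 < 1 - β₂ ^ (t + 1) := by
  have : β₂ ^ (t + 1) < 1 := pow_lt_one₀ hβ₂0 hβ₂1 (by omega)
  linarith

/-- Every stochastic gradient enters `v` with weight `1 - β₂` and is remembered by the maximum. -/
lemma abs_stochGrad_le_sqrt_vhat (hβ₂0 : 0 ≤ β₂) (hβ₂1 : β₂ < 1) (t : ℕ) (i : Fin d) :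
    |stochGrad β₁ β₂ β₁ₜ w₁ Fs (t + 1) i| ≤ 1 / √(1 - β₂) * √((st (t + 1)).vhat i) := by
  have hb : 0 < 1 - β₂ := by linarith
  have hp := one_sub_pow_pos hβ₂0 hβ₂1 t
  have hv := v_nonneg (β₁ := β₁) (β₁ₜ := β₁ₜ) (w₁ := w₁) (Fs := Fs) hβ₂0 hβ₂1 t i
  have h1 : (1 - β₂) * stochGrad β₁ β₂ β₁ₜ w₁ Fs (t + 1) i ^ 2 ≤ (st (t + 1)).vhat i := by
    calc _ ≤ (st (t + 1)).v i := by
          rw [adamState_succ_v]; linarith [mul_nonneg hβ₂0 hv]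
      _ ≤ (st (t + 1)).v i / (1 - β₂ ^ (t + 1)) :=
          le_div_self (v_nonneg hβ₂0 hβ₂1 _ i) hp (by linarith [pow_nonneg hβ₂0 (t + 1)])
      _ ≤ _ := le_max_right _ _
  have h2 := Real.sqrt_le_sqrt h1
  rw [Real.sqrt_mul hb.le, Real.sqrt_sq_eq_abs] at h2
  rw [one_div, ← div_eq_inv_mul, le_div_iff₀ (by positivity)]
  linarith

lemma one_le_inv_sqrt_one_sub (hβ₂0 : 0 ≤ β₂) (hβ₂1 : β₂ < 1) : 1 ≤ 1 / √(1 - β₂) := by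
  have hb : 0 < 1 - β₂ := by linarith
  rw [le_div_iff₀ (by positivity), one_mul, Real.sqrt_le_iff]
  constructor <;> linarith

lemma abs_m_le_sqrt_vhat (hβ₂0 : 0 ≤ β₂) (hβ₂1 : β₂ < 1) (hβ : ∀ t, 0 ≤ β₁ₜ (t + 1))
    (hβ' : ∀ t, β₁ₜ (t + 1) ≤ 1) (t : ℕ) (i : Fin d) :
    |(st t).m i| ≤ 1 / √(1 - β₂) * √((st t).vhat i) := by
  induction t with
  | zero => simp [adamState]
  | succ t ih =>
    have hC : 0 ≤ 1 / √(1 - β₂) := by positivity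
    have hg := abs_stochGrad_le_sqrt_vhat (β₁ := β₁) (β₁ₜ := β₁ₜ) (w₁ := w₁) (Fs := Fs)
      hβ₂0 hβ₂1 t i
    have hm := ih.trans (mul_le_mul_of_nonneg_left (sqrt_vhat_le_succ t i) hC)
    have h0 := hβ t
    have h1 : 0 ≤ 1 - β₁ₜ (t + 1) := by linarith [hβ' t]
    rw [adamState_succ_m]
    refine (abs_add_le _ _).trans ?_
    rw [abs_mul, abs_mul, abs_of_nonneg h0, abs_of_nonneg h1]
    have := mul_le_mul_of_nonneg_left hg h1
    have := mul_le_mul_of_nonneg_left hm h0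
    linarith

/-- The bias correction is exact: `v⁽ᵗ⁾ / (1 - β₂ᵗ)` is a weighted mean of squared gradients. -/
lemma sqrt_vhat_le (hβ₂0 : 0 ≤ β₂) (hβ₂1 : β₂ < 1) {G : ℝ} (hG : 0 ≤ G)
    (hg : ∀ t, ‖stochGrad β₁ β₂ β₁ₜ w₁ Fs (t + 1)‖ ≤ G) (t : ℕ) (i : Fin d) :
    √((st t).vhat i) ≤ G := by
  have hv : ∀ t, (st t).v i ≤ (1 - β₂ ^ t) * G ^ 2 := by
    intro t
    induction t with
    | zero => simp [adamState]
    | succ t ih =>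
      have h1 : stochGrad β₁ β₂ β₁ₜ w₁ Fs (t + 1) i ^ 2 ≤ G ^ 2 :=
        sq_le_sq' (by linarith [(abs_le.1 ((PiLp.norm_apply_le _ i).trans (hg t))).1])
          (abs_le.1 ((PiLp.norm_apply_le _ i).trans (hg t))).2
      rw [adamState_succ_v, pow_succ β₂]
      nlinarith [mul_le_mul_of_nonneg_left ih hβ₂0,
        mul_le_mul_of_nonneg_left h1 (by linarith : 0 ≤ 1 - β₂)]
  refine Real.sqrt_le_iff.2 ⟨hG, ?_⟩
  induction t with
  | zero => simp [adamState]; positivity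
  | succ t ih =>
    rw [adamState_succ_vhat]
    refine max_le ih ?_
    rw [div_le_iff₀ (one_sub_pow_pos hβ₂0 hβ₂1 t), mul_comm]
    exact hv (t + 1)

lemma norm_sq_adamUpdate_le (hβ₁0 : 0 ≤ β₁) (hβ₁1 : β₁ < 1) (hβ₂0 : 0 ≤ β₂) (hβ₂1 : β₂ < 1)
    (hβ : ∀ t, 0 ≤ β₁ₜ (t + 1)) (hβ' : ∀ t, β₁ₜ (t + 1) ≤ 1) (t : ℕ) :
    ‖adamUpdate β₁ β₂ β₁ₜ w₁ Fs t‖ ^ 2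
      ≤ d * (1 / (1 - β₁) * (1 / √(1 - β₂))) ^ 2 * (1 / ((max t 1 : ℕ) : ℝ)) := by
  have hcoord : ∀ i, adamUpdate β₁ β₂ β₁ₜ w₁ Fs t i ^ 2
      ≤ (1 / (1 - β₁) * (1 / √(1 - β₂))) ^ 2 * (1 / ((max t 1 : ℕ) : ℝ)) := by
    intro i
    have hr : |(st t).m i / √((st t).vhat i)| ≤ 1 / √(1 - β₂) := by
      rw [abs_div, abs_of_nonneg (Real.sqrt_nonneg _)]
      exact div_le_of_le_mul₀ (Real.sqrt_nonneg _) (by positivity)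
        (abs_m_le_sqrt_vhat hβ₂0 hβ₂1 hβ hβ' t i)
    have h1 : |adamUpdate β₁ β₂ β₁ₜ w₁ Fs t i|
        ≤ 1 / √((max t 1 : ℕ) : ℝ) * (1 / (1 - β₁)) * (1 / √(1 - β₂)) := by
      change |effectiveStep β₁ t * _| ≤ _
      rw [abs_mul, abs_of_nonneg (effectiveStep_nonneg hβ₁0 hβ₁1 t)]
      exact mul_le_mul (effectiveStep_le hβ₁0 hβ₁1 t) hr (abs_nonneg _)
        ((effectiveStep_nonneg hβ₁0 hβ₁1 t).trans (effectiveStep_le hβ₁0 hβ₁1 t))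
    rw [← sq_abs]
    refine (pow_le_pow_left₀ (abs_nonneg _) h1 2).trans_eq ?_
    rw [mul_pow, mul_pow, mul_pow, div_pow 1 √((max t 1 : ℕ) : ℝ), Real.sq_sqrt (by positivity)]
    ring
  rw [EuclideanSpace.real_norm_sq_eq]
  refine (Finset.sum_le_sum fun i _ => hcoord i).trans_eq ?_
  simp [mul_assoc]

end Trajectory

/-! ### Descent along a trajectory -/

section Descent

variable {d : ℕ} {β₁ β₂ : ℝ} {β₁ₜ : ℕ → ℝ} {w₁ : Param d} {Fs : ℕ → Param d → ℝ} {F : Param d → ℝ}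

local notation "st" => adamState β₁ β₂ β₁ₜ w₁ Fs
local notation "upd" => adamUpdate β₁ β₂ β₁ₜ w₁ Fs
local notation "iter" => adamIterate β₁ β₂ β₁ₜ w₁ Fs

/-- The one-sided quadratic bound makes the gradient one-sided Lipschitz. The gradient itself need
not be Lipschitz, and this is all that the comparison of consecutive momentum terms uses. -/
lemma inner_gradient_sub_le {L : ℝ}
    (hF : ∀ x y : Param d, F y - F x ≤ inner ℝ (gradient F x) (y - x) + L / 2 * ‖y - x‖ ^ 2)
    (x z : Param d) :
    inner ℝ (gradient F x) z - L * ‖z‖ ^ 2 ≤ inner ℝ (gradient F (x - z)) z := by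
  have h1 := hF x (x - z)
  have h2 := hF (x - z) x
  rw [show x - z - x = -z by abel, inner_neg_right, norm_neg] at h1
  rw [show x - (x - z) = z by abel] at h2
  linarith

lemma inner_gradient_adamUpdate (x : Param d) (t : ℕ) :
    inner ℝ (gradient F x) (upd t) = effectiveStep β₁ t *
      ∑ i, gradient F x i * ((st t).m i / √((st t).vhat i)) := by
  rw [PiLp.inner_apply, Finset.mul_sum]
  refine Finset.sum_congr rfl fun i _ => ?_
  rw [RCLike.inner_apply, conj_trivial]
  change effectiveStep β₁ t * _ * _ = _
  ring

/-- One-step estimate: the products `⟪∇F(w⁽ᵗ⁾), w⁽ᵗ⁾ - w⁽ᵗ⁺¹⁾⟫` satisfy a discounted recursion with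
the squared gradient as gain. -/
lemma inner_gradient_adamUpdate_succ_ge {b L G ε : ℝ} (hβ₁0 : 0 ≤ β₁) (hβ₁1 : β₁ < 1)
    (hβ₂0 : 0 ≤ β₂) (hβ₂1 : β₂ < 1) (hb1 : b < 1) (hβ : ∀ t, 0 ≤ β₁ₜ (t + 1))
    (hβ' : ∀ t, β₁ₜ (t + 1) ≤ b) (hL : 0 < L) (hG : 0 ≤ G) (hε : 0 < ε) (hε1 : ε ≤ 1)
    (hF : ∀ x y : Param d, F y - F x ≤ inner ℝ (gradient F x) (y - x) + L / 2 * ‖y - x‖ ^ 2)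
    (hFG : ∀ t, ‖gradient F (iter (t + 1))‖ ≤ G)
    (hg : ∀ t, ‖stochGrad β₁ β₂ β₁ₜ w₁ Fs (t + 1)‖ ≤ G) (t : ℕ) :
    β₁ₜ (t + 1) * inner ℝ (gradient F (iter t)) (upd t)
      + (1 - b) / (G + 1) * (1 / √((t : ℝ) + 1) * ‖gradient F (iter (t + 1))‖ ^ 2)
      - (L * ‖upd t‖ ^ 2
        + d * (G * (1 / √(1 - β₂))) * (effectiveStep β₁ t - effectiveStep β₁ (t + 1))
        + effectiveStep β₁ (t + 1) * ∑ i,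
          (4 * (1 / √(1 - β₂)) ^ 2 * (√((st (t + 1)).vhat i) - √((st t).vhat i) + ε)
          + (1 / √(1 - β₂) + 1) * (2 * G / Real.log 2)
            * (Real.log (√((st (t + 1)).vhat i) + ε) - Real.log (√((st t).vhat i) + ε))))
      + effectiveStep β₁ (t + 1) *
        ∑ i, noiseWeight (1 / √(1 - β₂)) ε (β₁ₜ (t + 1)) (gradient F (st t).w i)
          √((st t).vhat i) * gradNoise F β₁ β₂ β₁ₜ w₁ Fs (t + 1) i
      ≤ inner ℝ (gradient F (iter (t + 1))) (upd (t + 1)) := by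
  have hC : 1 ≤ 1 / √(1 - β₂) := one_le_inv_sqrt_one_sub hβ₂0 hβ₂1
  have hβ1 : ∀ t, β₁ₜ (t + 1) ≤ 1 := fun t => (hβ' t).trans hb1.le
  set C := 1 / √(1 - β₂)
  set e := effectiveStep β₁ t
  set e' := effectiveStep β₁ (t + 1)
  set B := β₁ₜ (t + 1)
  set a := gradient F (iter (t + 1)) with ha_def
  have he' : 0 ≤ e' := effectiveStep_nonneg hβ₁0 hβ₁1 _
  have hee : e' ≤ e := effectiveStep_succ_le hβ₁0 hβ₁1 t
  have hinv : 1 / √((t : ℝ) + 1) ≤ e' := inv_sqrt_le_effectiveStep hβ₁0 hβ₁1 t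
  have hB0 : 0 ≤ B := hβ t
  have hB1 : B ≤ 1 := hβ1 t
  have hcoord : ∀ i, B * (e * (a i * ((st t).m i / √((st t).vhat i))))
      + (1 - b) / (G + 1) * (1 / √((t : ℝ) + 1)) * a i ^ 2
      + e' * (noiseWeight C ε B (a i) √((st t).vhat i) * gradNoise F β₁ β₂ β₁ₜ w₁ Fs (t + 1) i)
      - G * C * (e - e')
      - e' * (4 * C ^ 2 * (√((st (t + 1)).vhat i) - √((st t).vhat i) + ε)
          + (C + 1) * (2 * G / Real.log 2)
            * (Real.log (√((st (t + 1)).vhat i) + ε) - Real.log (√((st t).vhat i) + ε)))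
      ≤ e' * (a i * ((st (t + 1)).m i / √((st (t + 1)).vhat i))) := by
    intro i
    have hai : |a i| ≤ G := (PiLp.norm_apply_le _ i).trans (hFG t)
    have hm := abs_m_le_sqrt_vhat (β₁ := β₁) (w₁ := w₁) (Fs := Fs) hβ₂0 hβ₂1 hβ hβ1 t i
    have hstep := mul_le_mul_of_nonneg_left (le_mul_momentum_div hC hε hε1 hB0 hB1
      (Real.sqrt_nonneg _) (sqrt_vhat_le_succ t i) (sqrt_vhat_le hβ₂0 hβ₂1 hG hg (t + 1) i)
      hai ((PiLp.norm_apply_le _ i).trans (hg t)) (abs_stochGrad_le_sqrt_vhat hβ₂0 hβ₂1 t i) hm) he'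
    have hn : stochGrad β₁ β₂ β₁ₜ w₁ Fs (t + 1) i - a i
        = gradNoise F β₁ β₂ β₁ₜ w₁ Fs (t + 1) i := rfl
    rw [hn] at hstep
    rw [adamState_succ_m]
    have hρ : |a i * ((st t).m i / √((st t).vhat i))| ≤ G * C := by
      rw [abs_mul, abs_div, abs_of_nonneg (Real.sqrt_nonneg _)]
      exact mul_le_mul hai (div_le_of_le_mul₀ (Real.sqrt_nonneg _) (by linarith) hm)
        (by positivity) hG
    -- the old momentum term carries the larger step `e`; the differences `e - e'` telescope
    have hdec : B * (e * (a i * ((st t).m i / √((st t).vhat i)))) - G * C * (e - e')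
        ≤ e' * (B * (a i * ((st t).m i / √((st t).vhat i)))) := by
      have h1 := mul_le_mul_of_nonneg_left (abs_le.1 hρ).2 (by linarith : 0 ≤ e - e')
      have h2 := mul_le_mul_of_nonneg_left h1 hB0
      have h3 : B * ((e - e') * (G * C)) ≤ 1 * ((e - e') * (G * C)) :=
        mul_le_mul_of_nonneg_right hB1 (mul_nonneg (by linarith) (by positivity))
      linarith
    -- the bias correction only enlarges the step: `1 / √(t + 1) ≤ e'`
    have hgain : (1 - b) / (G + 1) * (1 / √((t : ℝ) + 1)) * a i ^ 2
        ≤ e' * ((1 - B) * (a i ^ 2 / (G + 1))) := by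
      have h1 : (1 - b) * (1 / √((t : ℝ) + 1)) ≤ (1 - B) * e' :=
        mul_le_mul (by linarith [hβ' t]) hinv (by positivity) (by linarith)
      calc _ = (1 - b) * (1 / √((t : ℝ) + 1)) * (a i ^ 2 / (G + 1)) := by ring
        _ ≤ (1 - B) * e' * (a i ^ 2 / (G + 1)) :=
          mul_le_mul_of_nonneg_right h1 (by positivity)
        _ = _ := by ring
    linarith
  have hsum := Finset.sum_le_sum fun i (_ : i ∈ Finset.univ) => hcoord i
  have hA : inner ℝ a (upd t) = e * ∑ i, a i * ((st t).m i / √((st t).vhat i)) :=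
    inner_gradient_adamUpdate _ t
  have hA' : inner ℝ a (upd (t + 1))
      = e' * ∑ i, a i * ((st (t + 1)).m i / √((st (t + 1)).vhat i)) :=
    inner_gradient_adamUpdate _ (t + 1)
  simp only [Finset.sum_sub_distrib, Finset.sum_add_distrib] at hsum
  rw [← Finset.mul_sum, ← Finset.mul_sum, ← Finset.mul_sum, ← Finset.mul_sum, ← Finset.mul_sum,
    ← Finset.mul_sum, ← Finset.mul_sum, ← hA, ← hA', ← EuclideanSpace.real_norm_sq_eq, Finset.sum_add_distrib,
    Finset.sum_const, Finset.card_univ, Fintype.card_fin, nsmul_eq_mul] at hsum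
  have hmono := inner_gradient_sub_le hF (iter t) (upd t)
  rw [← adamIterate_succ, ← ha_def] at hmono
  have h1 := mul_le_mul_of_nonneg_left hmono hB0
  have h2 : B * (L * ‖upd t‖ ^ 2) ≤ L * ‖upd t‖ ^ 2 :=
    mul_le_of_le_one_left (by positivity) hB1
  rw [Finset.sum_add_distrib]
  change _ + e' * ∑ i, noiseWeight C ε B (a i) √((st t).vhat i)
    * gradNoise F β₁ β₂ β₁ₜ w₁ Fs (t + 1) i ≤ _
  linarith

/-- The one-step errors have a sum of order `log T` when the regularization is `ε = 1 / √T`: the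
increments of `√v̂` and of `log (√v̂ + ε)` telescope. -/
lemma sum_effectiveStep_mul_growth_le {G c₁ c₂ : ℝ} (hβ₁0 : 0 ≤ β₁) (hβ₁1 : β₁ < 1)
    (hβ₂0 : 0 ≤ β₂) (hβ₂1 : β₂ < 1) (hG : 0 ≤ G) (hc₁ : 0 ≤ c₁) (hc₂ : 0 ≤ c₂)
    (hg : ∀ t, ‖stochGrad β₁ β₂ β₁ₜ w₁ Fs (t + 1)‖ ≤ G) {T : ℕ} (hT : 1 ≤ T) :
    ∑ t ∈ Finset.range T, effectiveStep β₁ (t + 1) * ∑ i,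
        (c₁ * (√((st (t + 1)).vhat i) - √((st t).vhat i) + 1 / √(T : ℝ))
          + c₂ * (Real.log (√((st (t + 1)).vhat i) + 1 / √(T : ℝ))
            - Real.log (√((st t).vhat i) + 1 / √(T : ℝ))))
      ≤ d * (1 / (1 - β₁) * (c₁ * (G + 2) + c₂ * (Real.log (G + 1) + Real.log T))) := by
  have hT' : (1 : ℝ) ≤ T := by exact_mod_cast hT
  have hsT : 1 ≤ √(T : ℝ) := Real.one_le_sqrt.2 hT'
  have hq : 0 ≤ 1 / (1 - β₁) := by
    have : 0 < 1 - β₁ := by linarith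
    positivity
  set q := 1 / (1 - β₁)
  set ε := 1 / √(T : ℝ) with hε_def
  have hε : 0 < ε := by positivity
  have hε1 : ε ≤ 1 := by rw [hε_def, div_le_one (by positivity)]; exact hsT
  have hcoord : ∀ i, ∑ t ∈ Finset.range T, effectiveStep β₁ (t + 1) *
        (c₁ * (√((st (t + 1)).vhat i) - √((st t).vhat i) + ε)
          + c₂ * (Real.log (√((st (t + 1)).vhat i) + ε) - Real.log (√((st t).vhat i) + ε)))
      ≤ q * (c₁ * (G + 2) + c₂ * (Real.log (G + 1) + Real.log T)) := by
    intro i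
    have hterm : ∀ t ∈ Finset.range T, effectiveStep β₁ (t + 1) *
        (c₁ * (√((st (t + 1)).vhat i) - √((st t).vhat i) + ε)
          + c₂ * (Real.log (√((st (t + 1)).vhat i) + ε) - Real.log (√((st t).vhat i) + ε)))
        ≤ q * (c₁ * (√((st (t + 1)).vhat i) - √((st t).vhat i))
          + c₁ * ε * (1 / √((t : ℝ) + 1))
          + c₂ * (Real.log (√((st (t + 1)).vhat i) + ε) - Real.log (√((st t).vhat i) + ε))) := by
      intro t _
      have hJ := sqrt_vhat_le_succ (β₁ := β₁) (β₂ := β₂) (β₁ₜ := β₁ₜ) (w₁ := w₁) (Fs := Fs) t i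
      have hℓ : Real.log (√((st t).vhat i) + ε) ≤ Real.log (√((st (t + 1)).vhat i) + ε) :=
        Real.log_le_log (by positivity) (by linarith)
      have hJ' := mul_nonneg hc₁ (sub_nonneg.2 hJ)
      have hℓ' := mul_nonneg hc₂ (sub_nonneg.2 hℓ)
      have h1 := mul_le_mul_of_nonneg_right
        (effectiveStep_le_const hβ₁0 hβ₁1 (t + 1)) (add_nonneg hJ' hℓ')
      have h2 := mul_le_mul_of_nonneg_right
        (effectiveStep_le hβ₁0 hβ₁1 (t + 1)) (by positivity : 0 ≤ c₁ * ε)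
      have hmax : ((max (t + 1) 1 : ℕ) : ℝ) = (t : ℝ) + 1 := by
        rw [max_eq_left (by omega)]; push_cast; rfl
      rw [hmax] at h2
      linarith
    refine (Finset.sum_le_sum hterm).trans ?_
    rw [← Finset.mul_sum, Finset.sum_add_distrib, Finset.sum_add_distrib, ← Finset.mul_sum,
      ← Finset.mul_sum, ← Finset.mul_sum,
      Finset.sum_range_sub (fun t => √((st t).vhat i)),
      Finset.sum_range_sub (fun t => Real.log (√((st t).vhat i) + ε))]
    -- `v̂⁽⁰⁾ = 0`, so the logarithm starts at `log ε = -(log T) / 2`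
    have hu0 : √((st 0).vhat i) = 0 := by simp [adamState]
    have huT := sqrt_vhat_le hβ₂0 hβ₂1 hG hg T i
    have hinv : ε * ∑ t ∈ Finset.range T, 1 / √((t : ℝ) + 1) ≤ 2 := by
      calc _ ≤ ε * (2 * √(T : ℝ)) := mul_le_mul_of_nonneg_left (sum_inv_sqrt_le T) hε.le
        _ = 2 := by rw [hε_def]; field_simp
    have hlog : Real.log (√((st T).vhat i) + ε) - Real.log (√((st 0).vhat i) + ε)
        ≤ Real.log (G + 1) + Real.log T := by
      have h1 : Real.log (√((st T).vhat i) + ε) ≤ Real.log (G + 1) :=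
        Real.log_le_log (by positivity) (by linarith)
      have h2 : Real.log ε = -(Real.log T / 2) := by
        rw [hε_def, one_div, Real.log_inv, Real.log_sqrt (by positivity)]
      have h3 : 0 ≤ Real.log T := Real.log_nonneg hT'
      rw [hu0, zero_add, h2]
      linarith
    have h1 := mul_le_mul_of_nonneg_left hinv hc₁
    have h2 := mul_le_mul_of_nonneg_left hlog hc₂
    have h3 := mul_le_mul_of_nonneg_left huT hc₁
    refine mul_le_mul_of_nonneg_left ?_ hq
    rw [hu0] at h2 ⊢
    linarith
  simp_rw [Finset.mul_sum]
  rw [Finset.sum_comm]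
  refine (Finset.sum_le_sum fun i _ => hcoord i).trans_eq ?_
  simp

/-- Along every trajectory with bounded gradients, the weighted sum of the squared gradients is
`O(log T)` up to the filtered noise. -/
theorem sum_norm_gradient_sq_add_filteredNoise_le {L G f₀ q C D c₁ c₂ : ℝ} (hβ₁0 : 0 ≤ β₁)
    (hβ₁1 : β₁ < 1) (hβ₂0 : 0 ≤ β₂) (hβ₂1 : β₂ < 1) (hβ : ∀ t, 0 ≤ β₁ₜ (t + 1))
    (hβ' : ∀ t, β₁ₜ (t + 1) ≤ β₁) (hL : 0 < L) (hG : 0 ≤ G) (hf₀ : ∀ x, f₀ ≤ F x)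
    (hF : ∀ x y : Param d, F y - F x ≤ inner ℝ (gradient F x) (y - x) + L / 2 * ‖y - x‖ ^ 2)
    (hFG : ∀ t, ‖gradient F (iter (t + 1))‖ ≤ G)
    (hg : ∀ t, ‖stochGrad β₁ β₂ β₁ₜ w₁ Fs (t + 1)‖ ≤ G) {T : ℕ} (hT : 1 ≤ T)
    (hq_def : q = 1 / (1 - β₁)) (hC_def : C = 1 / √(1 - β₂)) (hD_def : D = d * (q * C) ^ 2)
    (hc₁_def : c₁ = 4 * C ^ 2) (hc₂_def : c₂ = (C + 1) * (2 * G / Real.log 2)) :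
    (1 - β₁) / (G + 1) * ∑ t ∈ Finset.range T,
          1 / √((t : ℝ) + 1) * ‖gradient F (iter (t + 1))‖ ^ 2
        + ∑ t ∈ Finset.range T, filteredNoise F β₁ β₂ β₁ₜ w₁ Fs C (1 / √(T : ℝ)) (t + 1)
      ≤ F w₁ - f₀ + L / 2 * (D * (1 + Real.log T))
        + q * (L * (2 * D * (1 + Real.log T)) + d * (G * C) * q
          + d * (q * (c₁ * (G + 2) + c₂ * (Real.log (G + 1) + Real.log T)))) := by
  have hb : 0 < 1 - β₁ := by linarith
  have hq : 0 ≤ q := by rw [hq_def]; positivity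
  have hC1 : 1 ≤ C := hC_def ▸ one_le_inv_sqrt_one_sub hβ₂0 hβ₂1
  have hlog2 : 0 < Real.log 2 := Real.log_pos (by norm_num)
  have hc₁ : 0 ≤ c₁ := by rw [hc₁_def]; positivity
  have hc₂ : 0 ≤ c₂ := by rw [hc₂_def]; positivity
  have hβ1 : ∀ t, β₁ₜ (t + 1) ≤ 1 := fun t => (hβ' t).trans hβ₁1.le
  have hT' : (1 : ℝ) ≤ T := by exact_mod_cast hT
  have hε : 0 < 1 / √(T : ℝ) := by positivity
  have hε1 : 1 / √(T : ℝ) ≤ 1 := by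
    rw [div_le_one (by positivity)]; exact Real.one_le_sqrt.2 hT'
  have hgrow := sum_effectiveStep_mul_growth_le (c₁ := c₁) (c₂ := c₂) (w₁ := w₁) (Fs := Fs)
    (β₁ₜ := β₁ₜ) hβ₁0 hβ₁1 hβ₂0 hβ₂1 hG hc₁ hc₂ hg hT
  rw [← hq_def] at hgrow
  set ε := 1 / √(T : ℝ)
  have hupd : ∀ t, ‖upd t‖ ^ 2 ≤ D * (1 / ((max t 1 : ℕ) : ℝ)) := by
    rw [hD_def, hq_def, hC_def]
    exact norm_sq_adamUpdate_le hβ₁0 hβ₁1 hβ₂0 hβ₂1 hβ hβ1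
  have hharm := sum_inv_le_one_add_log T
  have hD : 0 ≤ D := by rw [hD_def]; positivity
  have hupd_sum : ∑ t ∈ Finset.range T, ‖upd (t + 1)‖ ^ 2 ≤ D * (1 + Real.log T) := by
    calc _ ≤ ∑ t ∈ Finset.range T, D * (1 / ((t : ℝ) + 1)) := by
          refine Finset.sum_le_sum fun t _ => (hupd (t + 1)).trans_eq ?_
          rw [max_eq_left (by omega)]; push_cast; rfl
      _ ≤ _ := by rw [← Finset.mul_sum]; exact mul_le_mul_of_nonneg_left hharm hD
  have hupd_sum' : ∑ t ∈ Finset.range T, ‖upd t‖ ^ 2 ≤ 2 * D * (1 + Real.log T) := by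
    calc _ ≤ ∑ t ∈ Finset.range T, 2 * D * (1 / ((t : ℝ) + 1)) := by
          refine Finset.sum_le_sum fun t _ => (hupd t).trans ?_
          have h1 : (t : ℝ) + 1 ≤ 2 * ((max t 1 : ℕ) : ℝ) := by
            exact_mod_cast (by omega : t + 1 ≤ 2 * max t 1)
          have h2 : 1 / ((max t 1 : ℕ) : ℝ) ≤ 2 * (1 / ((t : ℝ) + 1)) := by
            rw [mul_one_div, div_le_div_iff₀ (by positivity) (by positivity)]
            linarith
          calc _ ≤ D * (2 * (1 / ((t : ℝ) + 1))) := mul_le_mul_of_nonneg_left h2 hD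
            _ = _ := by ring
      _ ≤ _ := by rw [← Finset.mul_sum]; exact mul_le_mul_of_nonneg_left hharm (by positivity)
  have hstep_sum : ∑ t ∈ Finset.range T, (effectiveStep β₁ t - effectiveStep β₁ (t + 1)) ≤ q := by
    rw [Finset.sum_range_sub', hq_def]
    linarith [effectiveStep_le_const hβ₁0 hβ₁1 0, effectiveStep_nonneg hβ₁0 hβ₁1 T]
  have hdescent : ∑ t ∈ Finset.range T, inner ℝ (gradient F (iter (t + 1))) (upd (t + 1))
      ≤ F w₁ - f₀ + L / 2 * ∑ t ∈ Finset.range T, ‖upd (t + 1)‖ ^ 2 := by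
    have h1 : ∀ t ∈ Finset.range T, inner ℝ (gradient F (iter (t + 1))) (upd (t + 1))
        ≤ (F (iter (t + 1)) - F (iter (t + 1 + 1))) + L / 2 * ‖upd (t + 1)‖ ^ 2 := by
      intro t _
      have h := hF (iter (t + 1)) (iter (t + 1 + 1))
      rw [adamIterate_succ (t + 1), show ∀ x y : Param d, x - y - x = -y by intros; abel,
        inner_neg_right, norm_neg, ← adamIterate_succ (t + 1)] at h
      linarith
    refine (Finset.sum_le_sum h1).trans ?_
    rw [Finset.sum_add_distrib, ← Finset.mul_sum,
      Finset.sum_range_sub' (fun t => F (iter (t + 1)))]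
    have : iter (0 + 1) = w₁ := rfl
    rw [this]
    linarith [hf₀ (iter (T + 1))]
  have hrec := sum_gain_le_of_discounted_recursion hβ₁0 hβ₁1 (β := β₁ₜ)
    (a := fun t => inner ℝ (gradient F (iter t)) (upd t))
    (r := filteredNoise F β₁ β₂ β₁ₜ w₁ Fs C ε)
    (x := fun t => (1 - β₁) / (G + 1) * (1 / √(t : ℝ) * ‖gradient F (iter t)‖ ^ 2))
    (y := fun t => L * ‖upd (t - 1)‖ ^ 2
        + d * (G * C) * (effectiveStep β₁ (t - 1) - effectiveStep β₁ t)
        + effectiveStep β₁ t * ∑ i,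
          (c₁ * (√((st t).vhat i) - √((st (t - 1)).vhat i) + ε)
          + c₂ * (Real.log (√((st t).vhat i) + ε) - Real.log (√((st (t - 1)).vhat i) + ε))))
    (ν := fun t => effectiveStep β₁ t * ∑ i, noiseWeight C ε (β₁ₜ t)
        (gradient F (st (t - 1)).w i) √((st (t - 1)).vhat i) * gradNoise F β₁ β₂ β₁ₜ w₁ Fs t i)
    hβ hβ' ?_ rfl (fun t => rfl) ?_ ?_ ?_ T
  · simp only [Nat.cast_add, Nat.cast_one, Nat.add_sub_cancel] at hrec
    rw [Finset.sum_add_distrib, Finset.sum_add_distrib, ← Finset.mul_sum, ← Finset.mul_sum,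
      ← Finset.mul_sum, ← hq_def] at hrec
    have h1 := mul_le_mul_of_nonneg_left hupd_sum (by positivity : 0 ≤ L / 2)
    have h2 := mul_le_mul_of_nonneg_left hupd_sum' hL.le
    have h3 := mul_le_mul_of_nonneg_left hstep_sum (by positivity : 0 ≤ d * (G * C))
    have h4 := mul_le_mul_of_nonneg_left (add_le_add (add_le_add h2 h3) hgrow) hq
    linarith
  · have : upd 0 = 0 := by ext i; simp [adamUpdate, adamState]
    simp [this]
  · intro t
    have := inner_gradient_adamUpdate_succ_ge (w₁ := w₁) (Fs := Fs) hβ₁0 hβ₁1 hβ₂0 hβ₂1 hβ₁1 hβ hβ'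
      hL hG hε hε1 hF hFG hg t
    rw [← hC_def, ← hc₁_def, ← hc₂_def] at this
    simpa only [Nat.cast_add, Nat.cast_one, Nat.add_sub_cancel] using this
  · intro t
    positivity
  · intro t
    simp only [Nat.add_sub_cancel]
    have h1 := effectiveStep_succ_le hβ₁0 hβ₁1 t
    have h2 := effectiveStep_nonneg hβ₁0 hβ₁1 (t + 1)
    refine add_nonneg (add_nonneg (by positivity)
      (mul_nonneg (by positivity) (by linarith))) (mul_nonneg h2 (Finset.sum_nonneg fun i _ => ?_))
    have hJ := sqrt_vhat_le_succ (β₁ := β₁) (β₂ := β₂) (β₁ₜ := β₁ₜ) (w₁ := w₁) (Fs := Fs) t i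
    have hℓ : Real.log (√((st t).vhat i) + ε) ≤ Real.log (√((st (t + 1)).vhat i) + ε) :=
      Real.log_le_log (by positivity) (by linarith)
    exact add_nonneg (mul_nonneg (by positivity) (by linarith)) (mul_nonneg hc₂ (by linarith))

end Descent

/-- The trajectory bound with its constants hidden: they depend on neither the sampled objectives
nor the number of iterations. -/
theorem exists_sum_norm_gradient_sq_add_filteredNoise_le {d : ℕ} {β₁ β₂ : ℝ} {β₁ₜ : ℕ → ℝ}
    (F : Param d → ℝ) (w₁ : Param d) {L G f₀ : ℝ} (hβ₁0 : 0 ≤ β₁) (hβ₁1 : β₁ < 1)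
    (hβ₂0 : 0 ≤ β₂) (hβ₂1 : β₂ < 1) (hβ : ∀ t, 0 ≤ β₁ₜ (t + 1))
    (hβ' : ∀ t, β₁ₜ (t + 1) ≤ β₁) (hL : 0 < L) (hG : 0 ≤ G) (hf₀ : ∀ x, f₀ ≤ F x)
    (hF : ∀ x y : Param d, F y - F x ≤ inner ℝ (gradient F x) (y - x) + L / 2 * ‖y - x‖ ^ 2) :
    ∃ K₀ K₁ : ℝ, ∀ Fs : ℕ → Param d → ℝ,
      (∀ t, ‖gradient F (adamIterate β₁ β₂ β₁ₜ w₁ Fs (t + 1))‖ ≤ G) →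
      (∀ t, ‖stochGrad β₁ β₂ β₁ₜ w₁ Fs (t + 1)‖ ≤ G) → ∀ T : ℕ, 1 ≤ T →
      (1 - β₁) / (G + 1) * ∑ t ∈ Finset.range T,
          1 / √((t : ℝ) + 1) * ‖gradient F (adamIterate β₁ β₂ β₁ₜ w₁ Fs (t + 1))‖ ^ 2
        + ∑ t ∈ Finset.range T,
          filteredNoise F β₁ β₂ β₁ₜ w₁ Fs (1 / √(1 - β₂)) (1 / √(T : ℝ)) (t + 1)
        ≤ K₀ + K₁ * Real.log T := by
  set q := 1 / (1 - β₁) with hq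
  set C := 1 / √(1 - β₂) with hC
  set D := d * (q * C) ^ 2 with hD
  set c₁ := 4 * C ^ 2 with hc₁
  set c₂ := (C + 1) * (2 * G / Real.log 2) with hc₂
  refine ⟨F w₁ - f₀ + L / 2 * D + q * (L * (2 * D) + d * (G * C) * q
      + d * (q * (c₁ * (G + 2) + c₂ * Real.log (G + 1)))),
    L / 2 * D + q * (L * (2 * D) + d * (q * c₂)), fun Fs hFG hg T hT => ?_⟩
  refine (sum_norm_gradient_sq_add_filteredNoise_le hβ₁0 hβ₁1 hβ₂0 hβ₂1 hβ hβ' hL hG hf₀ hF hFG hg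
    hT hq hC hD hc₁ hc₂).trans_eq ?_
  ring

/-! ### Measurability and centred noise -/

lemma measurable_gradient {d : ℕ} (F : Param d → ℝ) : Measurable (gradient F) :=
  (InnerProductSpace.toDual ℝ (Param d)).symm.continuous.measurable.comp (measurable_fderiv ℝ F)

lemma measurable_noiseWeight (C ε β : ℝ) :
    Measurable fun p : ℝ × ℝ => noiseWeight C ε β p.1 p.2 := by
  unfold noiseWeight
  refine Measurable.ite (measurableSet_lt (by fun_prop) (by fun_prop)) ?_ ?_ <;> fun_prop

lemma abs_noiseWeight_le {C ε β u : ℝ} (hC : 1 ≤ C) (hε : 0 < ε) (hβ : 0 ≤ β) (hβ1 : β ≤ 1)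
    (hu : 0 ≤ u) (a : ℝ) : |noiseWeight C ε β a u| ≤ 4 * C + 2 := by
  unfold noiseWeight
  have h1β : 0 ≤ 1 - β := by linarith
  split_ifs with h
  · have h1 : abs (a / |a|) ≤ 1 := by
      rw [abs_div, abs_abs]; exact div_self_le_one _
    have h0 : 0 ≤ (1 - β) * (2 * (C + 1)) + 2 * β * C := by positivity
    rw [abs_mul, abs_of_nonneg h0]
    calc _ ≤ ((1 - β) * (2 * (C + 1)) + 2 * β * C) * 1 := mul_le_mul_of_nonneg_left h1 h0
      _ ≤ _ := by nlinarith
  · have hp : 0 < u + ε := by positivity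
    have h1 : |a / (u + ε)| ≤ 4 * C := by
      rw [abs_div, abs_of_pos hp, div_le_iff₀ hp]; linarith
    rw [abs_mul, abs_of_nonneg h1β]
    calc _ ≤ 1 * (4 * C) := mul_le_mul (by linarith) h1 (abs_nonneg _) zero_le_one
      _ ≤ _ := by linarith

lemma measurable_adamStep {d : ℕ} {Ω : Type*} [MeasurableSpace Ω] (β₁ β₂ : ℝ) (β₁ₜ : ℕ → ℝ)
    (t : ℕ) {g : Ω → Param d} {s : Ω → AdamState d} (hg : Measurable g)
    (hw : Measurable fun ω => (s ω).w) (hm : Measurable fun ω => (s ω).m)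
    (hv : Measurable fun ω => (s ω).v) (hvh : Measurable fun ω => (s ω).vhat) :
    Measurable (fun ω => (adamStep β₁ β₂ β₁ₜ t (g ω) (s ω)).w) ∧
    Measurable (fun ω => (adamStep β₁ β₂ β₁ₜ t (g ω) (s ω)).m) ∧
    Measurable (fun ω => (adamStep β₁ β₂ β₁ₜ t (g ω) (s ω)).v) ∧
    Measurable (fun ω => (adamStep β₁ β₂ β₁ₜ t (g ω) (s ω)).vhat) := by
  have hcoord : ∀ {f : Ω → Param d}, Measurable f → ∀ i, Measurable fun ω => f ω i :=
    fun hf i => (EuclideanSpace.proj (𝕜 := ℝ) i).continuous.measurable.comp hf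
  have hmk : ∀ {f : Ω → Fin d → ℝ}, (∀ i, Measurable fun ω => f ω i) →
      Measurable fun ω => (WithLp.toLp 2 (f ω) : Param d) :=
    fun hf => (WithLp.measurable_toLp 2 _).comp (measurable_pi_iff.2 hf)
  have hwi := fun i => hcoord hw i
  have hmi := fun i => hcoord hm i
  have hvi := fun i => hcoord hv i
  have hvhi := fun i => hcoord hvh i
  have hgi := fun i => hcoord hg i
  simp only [adamStep]
  refine ⟨hmk fun i => ?_, by fun_prop, hmk fun i => ?_, hmk fun i => ?_⟩
  · simp only [PiLp.smul_apply, PiLp.add_apply]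
    fun_prop
  · fun_prop
  · fun_prop

/-- The state after `t` iterations is measurable with respect to `ℱ t` whenever `ℱ` is increasing
and `n_t` is `ℱ t`-measurable: since `g_t = n_t + ∇F(w⁽ᵗ⁾)`, the noise determines the trajectory, and
the sampled objectives themselves need not be measurable. -/
lemma measurable_adamState {d : ℕ} {Ω : Type*} (F : Param d → ℝ) (β₁ β₂ : ℝ) (β₁ₜ : ℕ → ℝ)
    (w₁ : Param d) (Fs : ℕ → Ω → Param d → ℝ) (ℱ : ℕ → MeasurableSpace Ω)
    (hmono : ∀ t, ℱ t ≤ ℱ (t + 1))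
    (hn : ∀ t, Measurable[ℱ (t + 1)]
      fun ω => gradNoise F β₁ β₂ β₁ₜ w₁ (fun s => Fs s ω) (t + 1)) (t : ℕ) :
    Measurable[ℱ t] (fun ω => (adamState β₁ β₂ β₁ₜ w₁ (fun s => Fs s ω) t).w) ∧
    Measurable[ℱ t] (fun ω => (adamState β₁ β₂ β₁ₜ w₁ (fun s => Fs s ω) t).m) ∧
    Measurable[ℱ t] (fun ω => (adamState β₁ β₂ β₁ₜ w₁ (fun s => Fs s ω) t).v) ∧
    Measurable[ℱ t] (fun ω => (adamState β₁ β₂ β₁ₜ w₁ (fun s => Fs s ω) t).vhat) := by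
  induction t with
  | zero =>
    exact ⟨measurable_const, measurable_const, measurable_const, measurable_const⟩
  | succ t ih =>
    obtain ⟨hw, hm, hv, hvh⟩ := ih
    have hw' := hw.mono (hmono t) le_rfl
    have hg : Measurable[ℱ (t + 1)]
        fun ω => stochGrad β₁ β₂ β₁ₜ w₁ (fun s => Fs s ω) (t + 1) := by
      have h := (hn t).add ((measurable_gradient F).comp hw')
      refine (congrArg _ (funext fun ω => ?_)).mp h
      exact sub_add_cancel _ _
    exact @measurable_adamStep d Ω (ℱ (t + 1)) β₁ β₂ β₁ₜ (t + 1) _ _ hg hw'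
      (hm.mono (hmono t) le_rfl) (hv.mono (hmono t) le_rfl) (hvh.mono (hmono t) le_rfl)

section Noise

variable {d : ℕ} {Ω : Type*}

/-- The σ-algebra generated by the first `t` terms of the sequence `N 1, N 2, …`. -/
@[reducible] def pastOf (N : ℕ → Ω → Param d) (t : ℕ) : MeasurableSpace Ω :=
  ⨆ k ∈ {k | k < t}, MeasurableSpace.comap (N (k + 1)) inferInstance

lemma pastOf_le_succ (N : ℕ → Ω → Param d) (t : ℕ) : pastOf N t ≤ pastOf N (t + 1) :=
  biSup_mono fun _ hk => Nat.lt_succ_of_lt hk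

lemma measurable_pastOf_succ (N : ℕ → Ω → Param d) (t : ℕ) :
    Measurable[pastOf N (t + 1)] (N (t + 1)) :=
  Measurable.of_comap_le (le_biSup (fun k => MeasurableSpace.comap (N (k + 1)) inferInstance)
    (Nat.lt_succ_self t))

variable [mΩ : MeasurableSpace Ω] {μ : Measure Ω}

lemma pastOf_le {N : ℕ → Ω → Param d} (hN : ∀ t, Measurable (N (t + 1))) (t : ℕ) :
    pastOf N t ≤ mΩ :=
  iSup₂_le fun k _ => (hN k).comap_le

/-- A bounded weight determined by the past does not correlate with the next noise vector. -/
lemma integrable_and_integral_mul_noise_eq_zero {N : ℕ → Ω → Param d}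
    (hN : ∀ t, Measurable (N (t + 1))) (hindep : iIndepFun (fun k => N (k + 1)) μ) {t : ℕ}
    (hint : Integrable (N (t + 1)) μ) (hmean : ∫ ω, N (t + 1) ω ∂μ = 0) {h : Ω → ℝ}
    (hh : Measurable[pastOf N t] h) {K : ℝ} (hK : ∀ ω, |h ω| ≤ K) (i : Fin d) :
    Integrable (fun ω => h ω * N (t + 1) ω i) μ ∧ ∫ ω, h ω * N (t + 1) ω i ∂μ = 0 := by
  have hhm : Measurable h := hh.mono (pastOf_le hN t) le_rfl
  have hproj : Measurable fun x : Param d => x i :=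
    (EuclideanSpace.proj (𝕜 := ℝ) i).continuous.measurable
  have hcoord : Measurable fun ω => N (t + 1) ω i := hproj.comp (hN t)
  have hcint : Integrable (fun ω => N (t + 1) ω i) μ :=
    (EuclideanSpace.proj (𝕜 := ℝ) i).integrable_comp hint
  refine ⟨hcint.bdd_mul hhm.aestronglyMeasurable (ae_of_all _ hK), ?_⟩
  -- `N (t + 1)` has index `t` in the independent family, and the past uses the indices below `t`
  have hdisj : Disjoint {k | k < t} {t} := by simp
  have hI := indep_iSup_of_disjoint (fun k => (hN k).comap_le) hindep hdisj
  have hI' : IndepFun h (fun ω => N (t + 1) ω i) μ := by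
    rw [IndepFun_iff_Indep]
    refine indep_of_indep_of_le_left (indep_of_indep_of_le_right hI ?_) hh.comap_le
    refine le_trans ?_ (le_biSup (fun k => MeasurableSpace.comap (N (k + 1)) inferInstance)
      (Set.mem_singleton t))
    rw [← measurable_iff_comap_le]
    exact hproj.comp (comap_measurable _)
  rw [hI'.integral_fun_mul_eq_mul_integral hhm.aestronglyMeasurable hcoord.aestronglyMeasurable]
  have : ∫ ω, N (t + 1) ω i ∂μ = 0 := by
    have h := (EuclideanSpace.proj (𝕜 := ℝ) i).integral_comp_comm hint
    rw [hmean, map_zero] at h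
    exact h
  rw [this, mul_zero]

/-- The filtered noise is centred. -/
lemma integrable_and_integral_filteredNoise_eq_zero [IsProbabilityMeasure μ] {F : Param d → ℝ} {β₁ β₂ : ℝ} {β₁ₜ : ℕ → ℝ}
    {w₁ : Param d} {Fs : ℕ → Ω → Param d → ℝ} {N : ℕ → Ω → Param d}
    (hN_def : ∀ t ω, N t ω = gradNoise F β₁ β₂ β₁ₜ w₁ (fun s => Fs s ω) t)
    (hβ : ∀ t, 0 ≤ β₁ₜ (t + 1)) (hβ' : ∀ t, β₁ₜ (t + 1) ≤ 1)
    (hN : ∀ t, Measurable (N (t + 1))) (hindep : iIndepFun (fun k => N (k + 1)) μ)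
    (hint : ∀ t, Integrable (N (t + 1)) μ) (hmean : ∀ t, ∫ ω, N (t + 1) ω ∂μ = 0)
    {C ε : ℝ} (hC : 1 ≤ C) (hε : 0 < ε) (t : ℕ) :
    Integrable (fun ω => filteredNoise F β₁ β₂ β₁ₜ w₁ (fun s => Fs s ω) C ε t) μ ∧
      ∫ ω, filteredNoise F β₁ β₂ β₁ₜ w₁ (fun s => Fs s ω) C ε t ∂μ = 0 := by
  induction t with
  | zero => simp [filteredNoise]
  | succ t ih =>
    obtain ⟨ih1, ih2⟩ := ih
    have hcoord : ∀ i : Fin d, Measurable fun x : Param d => x i := fun i =>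
      (EuclideanSpace.proj (𝕜 := ℝ) i).continuous.measurable
    have hstate := measurable_adamState F β₁ β₂ β₁ₜ w₁ Fs (pastOf N) (pastOf_le_succ N)
      (fun t => by simpa only [← hN_def] using measurable_pastOf_succ N t) t
    have hterm := fun i => integrable_and_integral_mul_noise_eq_zero hN hindep (hint t) (hmean t)
      (h := fun ω => noiseWeight C ε (β₁ₜ (t + 1))
        (gradient F (adamState β₁ β₂ β₁ₜ w₁ (fun s => Fs s ω) t).w i)
        √((adamState β₁ β₂ β₁ₜ w₁ (fun s => Fs s ω) t).vhat i))
      ((measurable_noiseWeight C ε (β₁ₜ (t + 1))).comp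
        (((hcoord i).comp ((measurable_gradient F).comp hstate.1)).prodMk
          ((hcoord i).comp hstate.2.2.2).sqrt))
      (fun ω => abs_noiseWeight_le hC hε (hβ t) (hβ' t) (Real.sqrt_nonneg _) _) i
    have hsum := integrable_finsetSum Finset.univ fun i _ => (hterm i).1
    simp only [filteredNoise, ← hN_def]
    refine ⟨(ih1.const_mul _).add (hsum.const_mul _), ?_⟩
    rw [integral_add (ih1.const_mul _) (hsum.const_mul _), integral_const_mul, integral_const_mul,
      ih2, integral_finsetSum _ fun i _ => (hterm i).1,
      Finset.sum_eq_zero fun i _ => (hterm i).2]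
    simp

end Noise

/-! ### From weighted sums to minima -/

lemma minUpTo_nonneg {e : ℕ → ℝ} (he : ∀ t, 0 ≤ e t) (T : ℕ) : 0 ≤ minUpTo e T :=
  Real.iInf_nonneg fun t => he t

lemma minUpTo_mul_sqrt_le {e : ℕ → ℝ} (he : ∀ t, 0 ≤ e t) (T : ℕ) :
    minUpTo e T * √(T : ℝ) ≤ ∑ t ∈ Finset.range T, 1 / √((t : ℝ) + 1) * e (t + 1) := by
  calc _ ≤ minUpTo e T * ∑ t ∈ Finset.range T, 1 / √((t : ℝ) + 1) :=
        mul_le_mul_of_nonneg_left (sqrt_le_sum_inv_sqrt T) (minUpTo_nonneg he T)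
    _ ≤ _ := by
      rw [Finset.mul_sum]
      refine Finset.sum_le_sum fun t ht => ?_
      rw [mul_comm]
      have hmem : t + 1 ∈ Finset.Icc 1 T :=
        Finset.mem_Icc.2 ⟨by omega, Finset.mem_range.1 ht⟩
      exact mul_le_mul_of_nonneg_left
        (ciInf_le (Set.finite_range _).bddBelow (⟨t + 1, hmem⟩ : Finset.Icc 1 T)) (by positivity)

lemma isBigO_log_div_sqrt_of_le {f : ℕ → ℝ} (hf : ∀ T, 0 ≤ f T) {G₁ G₂ : ℝ}
    (h : ∀ T : ℕ, 1 ≤ T → f T ≤ 1 / √(T : ℝ) * (G₁ + G₂ * Real.log T)) :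
    f =O[atTop] fun T : ℕ => Real.log T / √(T : ℝ) := by
  refine IsBigO.of_bound (|G₁| + |G₂|) ?_
  filter_upwards [eventually_ge_atTop 3] with T hT
  have hT3 : (3 : ℝ) ≤ T := by exact_mod_cast hT
  have hlog : 1 ≤ Real.log T := by
    rw [Real.le_log_iff_exp_le (by linarith)]
    linarith [Real.exp_one_lt_d9]
  rw [Real.norm_of_nonneg (hf T), Real.norm_of_nonneg (by positivity)]
  calc f T ≤ 1 / √(T : ℝ) * (G₁ + G₂ * Real.log T) := h T (by omega)
    _ ≤ 1 / √(T : ℝ) * ((|G₁| + |G₂|) * Real.log T) := by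
      refine mul_le_mul_of_nonneg_left ?_ (by positivity)
      nlinarith [le_abs_self G₁, le_abs_self G₂, abs_nonneg G₁]
    _ = _ := by ring

end AdamIBAL

theorem proposition1 {d : ℕ} {Ω : Type*} [MeasurableSpace Ω]
    (μ : Measure Ω) [IsProbabilityMeasure μ]
    -- the objective, the sampled objectives `F_t`, and the initial point
    (F : AdamIBAL.Param d → ℝ) (Fs : ℕ → Ω → AdamIBAL.Param d → ℝ) (w₁ : AdamIBAL.Param d)
    -- the parameters of the optimizer
    (β₁ β₂ : ℝ) (β₁ₜ : ℕ → ℝ)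
    (hβ₁ : 0 ≤ β₁ ∧ β₁ < 1) (hβ₂ : 0 ≤ β₂ ∧ β₂ < 1)
    (hβ₁ₜ : ∀ t, 1 ≤ t → 0 ≤ β₁ₜ t ∧ β₁ₜ t ≤ β₁)
    (hβ₁ₜ_anti : ∀ s t, 1 ≤ s → s ≤ t → β₁ₜ t ≤ β₁ₜ s)
    -- the iterates `w⁽ᵗ⁾`, the stochastic gradients `g_t` and the noise `n_t`
    (w g n : ℕ → Ω → AdamIBAL.Param d)
    (hw : ∀ t ω, w t ω = AdamIBAL.adamIterate β₁ β₂ β₁ₜ w₁ (fun s => Fs s ω) t)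
    (hg : ∀ t ω, g t ω = AdamIBAL.stochGrad β₁ β₂ β₁ₜ w₁ (fun s => Fs s ω) t)
    (hn : ∀ t ω, n t ω = AdamIBAL.gradNoise F β₁ β₂ β₁ₜ w₁ (fun s => Fs s ω) t)
    -- the objective is differentiable and bounded below, and the gradients `g_t` exist
    (hF_diff : Differentiable ℝ F) (hF_bdd : BddBelow (Set.range F))
    (hFs_diff : ∀ t, 1 ≤ t → ∀ᵐ ω ∂μ, DifferentiableAt ℝ (Fs t ω) (w t ω))
    -- `L`-Lipschitz gradient, in the sense of the quadratic upper bound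
    (L : ℝ) (hL : 0 < L)
    (hF_smooth : ∀ x y : AdamIBAL.Param d,
      F y - F x ≤ inner ℝ (gradient F x) (y - x) + L / 2 * ‖y - x‖ ^ 2)
    -- bounded true and stochastic gradients
    (G : ℝ)
    (hG_true : ∀ t, 1 ≤ t → ∀ᵐ ω ∂μ, ‖gradient F (w t ω)‖ ≤ G)
    (hG_stoch : ∀ t, 1 ≤ t → ∀ᵐ ω ∂μ, ‖g t ω‖ ≤ G)
    -- unbiased independent noise `n_1, n_2, …`
    (hn_meas : ∀ t, 1 ≤ t → Measurable (n t))
    (hn_mean : ∀ t, 1 ≤ t → ∫ ω, n t ω ∂μ = 0)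
    (hn_indep : iIndepFun (fun k : ℕ => n (k + 1)) μ)
    -- lower bound on the first stochastic gradient
    (c : ℝ) (hc : 0 < c) (hg_lower : ∀ᵐ ω ∂μ, c ≤ ‖g 1 ω‖) :
    (∀ t, 1 ≤ t → Integrable (fun ω => ‖gradient F (w t ω)‖ ^ 2) μ) ∧
    (∃ G₁ G₂ : ℝ, ∀ T : ℕ, 1 ≤ T →
      AdamIBAL.minUpTo (fun t => ∫ ω, ‖gradient F (w t ω)‖ ^ 2 ∂μ) T
        ≤ 1 / √(T : ℝ) * (G₁ + G₂ * Real.log T)) ∧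
    (fun T : ℕ => AdamIBAL.minUpTo (fun t => ∫ ω, ‖gradient F (w t ω)‖ ^ 2 ∂μ) T)
      =O[atTop] (fun T : ℕ => Real.log T / √(T : ℝ)) := by
  obtain ⟨ω₀, hω₀⟩ := (hG_true 1 le_rfl).exists
  have hG : 0 ≤ G := (norm_nonneg _).trans hω₀
  obtain ⟨f₀, hf₀⟩ := hF_bdd
  have hf₀' : ∀ x, f₀ ≤ F x := fun x => hf₀ (Set.mem_range_self x)
  have hβ : ∀ t, 0 ≤ β₁ₜ (t + 1) := fun t => (hβ₁ₜ (t + 1) (by omega)).1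
  have hβ' : ∀ t, β₁ₜ (t + 1) ≤ β₁ := fun t => (hβ₁ₜ (t + 1) (by omega)).2
  have hN : ∀ t, Measurable (n (t + 1)) := fun t => hn_meas (t + 1) (by omega)
  have hn_eq : ∀ t ω, n t ω = g t ω - gradient F (w t ω) := fun t ω => by
    rw [hn, hg, hw]; rfl
  have hn_int : ∀ t, Integrable (n (t + 1)) μ := fun t => by
    refine Integrable.of_bound (hN t).aestronglyMeasurable (G + G) ?_
    filter_upwards [hG_true (t + 1) (by omega), hG_stoch (t + 1) (by omega)] with ω h1 h2
    rw [hn_eq]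
    exact (norm_sub_le _ _).trans (add_le_add h2 h1)
  have hgrad_meas : ∀ t, Measurable fun ω => gradient F (w t ω) := fun t => by
    have h := (AdamIBAL.measurable_adamState F β₁ β₂ β₁ₜ w₁ Fs (AdamIBAL.pastOf n)
      (AdamIBAL.pastOf_le_succ n)
      (fun t => by simpa only [← hn] using AdamIBAL.measurable_pastOf_succ n t) (t - 1)).1
    have h' := (AdamIBAL.measurable_gradient F).comp
      (h.mono (AdamIBAL.pastOf_le hN (t - 1)) le_rfl)
    simp only [hw]
    exact h'
  have hgrad_int : ∀ t, 1 ≤ t → Integrable (fun ω => ‖gradient F (w t ω)‖ ^ 2) μ := by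
    intro t ht
    refine Integrable.of_bound ((hgrad_meas t).norm.pow_const 2).aestronglyMeasurable (G ^ 2) ?_
    filter_upwards [hG_true t ht] with ω h
    rw [norm_pow, norm_norm]
    exact pow_le_pow_left₀ (norm_nonneg _) h 2
  set e : ℕ → ℝ := fun t => ∫ ω, ‖gradient F (w t ω)‖ ^ 2 ∂μ
  have he : ∀ t, 0 ≤ e t := fun t => integral_nonneg fun ω => by positivity
  have hκ : 0 < (1 - β₁) / (G + 1) := div_pos (by linarith [hβ₁.2]) (by linarith)
  have hC : 1 ≤ 1 / √(1 - β₂) := AdamIBAL.one_le_inv_sqrt_one_sub hβ₂.1 hβ₂.2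
  obtain ⟨K₀, K₁, hK⟩ := AdamIBAL.exists_sum_norm_gradient_sq_add_filteredNoise_le F w₁
    hβ₁.1 hβ₁.2 hβ₂.1 hβ₂.2 hβ hβ' hL hG hf₀' hF_smooth
  have hsum : ∀ T : ℕ, 1 ≤ T → (1 - β₁) / (G + 1) *
      ∑ t ∈ Finset.range T, 1 / √((t : ℝ) + 1) * e (t + 1) ≤ K₀ + K₁ * Real.log T := by
    intro T hT
    have hT' : (1 : ℝ) ≤ T := by exact_mod_cast hT
    have hnoise := AdamIBAL.integrable_and_integral_filteredNoise_eq_zero hn hβ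
      (fun t => (hβ' t).trans hβ₁.2.le) hN hn_indep hn_int
      (fun t => hn_mean (t + 1) (by omega)) hC (by positivity : 0 < 1 / √(T : ℝ))
    have hI₁ : Integrable (fun ω => (1 - β₁) / (G + 1) * ∑ t ∈ Finset.range T,
        1 / √((t : ℝ) + 1) * ‖gradient F (w (t + 1) ω)‖ ^ 2) μ :=
      (integrable_finsetSum _ fun t _ => (hgrad_int (t + 1) (by omega)).const_mul _).const_mul _
    have hI₂ : Integrable (fun ω => ∑ t ∈ Finset.range T, AdamIBAL.filteredNoise F β₁ β₂ β₁ₜ w₁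
        (fun s => Fs s ω) (1 / √(1 - β₂)) (1 / √(T : ℝ)) (t + 1)) μ :=
      integrable_finsetSum _ fun t _ => (hnoise (t + 1)).1
    have hpath : ∀ᵐ ω ∂μ, (1 - β₁) / (G + 1) * ∑ t ∈ Finset.range T,
        1 / √((t : ℝ) + 1) * ‖gradient F (w (t + 1) ω)‖ ^ 2
        + ∑ t ∈ Finset.range T, AdamIBAL.filteredNoise F β₁ β₂ β₁ₜ w₁
        (fun s => Fs s ω) (1 / √(1 - β₂)) (1 / √(T : ℝ)) (t + 1) ≤ K₀ + K₁ * Real.log T := by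
      have h1 : ∀ᵐ ω ∂μ, ∀ t, ‖gradient F (w (t + 1) ω)‖ ≤ G :=
        ae_all_iff.2 fun t => hG_true (t + 1) (by omega)
      have h2 : ∀ᵐ ω ∂μ, ∀ t, ‖g (t + 1) ω‖ ≤ G :=
        ae_all_iff.2 fun t => hG_stoch (t + 1) (by omega)
      filter_upwards [h1, h2] with ω h1 h2
      simp only [hw, hg] at h1 h2 ⊢
      exact hK _ h1 h2 T hT
    have h := integral_mono_ae (hI₁.add hI₂) (integrable_const (K₀ + K₁ * Real.log T)) hpath
    rw [integral_add' hI₁ hI₂, integral_const_mul, integral_const, probReal_univ, one_smul,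
      integral_finsetSum _ fun t _ => (hgrad_int (t + 1) (by omega)).const_mul _,
      integral_finsetSum _ fun t _ => (hnoise (t + 1)).1,
      Finset.sum_eq_zero (fun t _ => (hnoise (t + 1)).2), add_zero] at h
    simpa only [integral_const_mul] using h
  have hmin : ∀ T : ℕ, 1 ≤ T → AdamIBAL.minUpTo e T ≤ 1 / √(T : ℝ) *
      ((G + 1) / (1 - β₁) * K₀ + (G + 1) / (1 - β₁) * K₁ * Real.log T) := by
    intro T hT
    have hT' : (1 : ℝ) ≤ T := by exact_mod_cast hT
    have h := (mul_le_mul_of_nonneg_left (AdamIBAL.minUpTo_mul_sqrt_le he T) hκ.le).trans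
      (hsum T hT)
    have hs : 0 < √(T : ℝ) := by positivity
    have h1 : AdamIBAL.minUpTo e T * √(T : ℝ)
        ≤ (G + 1) / (1 - β₁) * (K₀ + K₁ * Real.log T) := by
      rw [mul_comm, ← le_div_iff₀ hκ] at h
      refine h.trans_eq ?_
      rw [div_div_eq_mul_div]
      ring
    rw [one_div, ← div_eq_inv_mul, le_div_iff₀ hs]
    linarith
  exact ⟨hgrad_int, ⟨_, _, hmin⟩,
    AdamIBAL.isBigO_log_div_sqrt_of_le (AdamIBAL.minUpTo_nonneg he) hmin⟩
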